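/- All rings are commutative with identity. For a ring $A$ and an $A$-module $M$ let $\mathrm{pd}_A(M)$ and $\mathrm{fd}_A(M)$ be the projective and flat dimensions, and let the cotorsion dimension $\mathrm{cd}_A(M)\in\mathbb{N}\cup\{\infty\}$ be the least integer $n\ge 0$ such that $\mathrm{Ext}_A^{n+1}(F,M)=0$ for all flat $A$-modules $F$ ($\infty$ if there is none). Put $$\mathrm{cot.D}(A)=\sup_M \mathrm{cd}_A(M),\qquad \mathrm{wdim}(A)=\sup_M \mathrm{fd}_A(M),$$ $$\mathrm{FPD}(A)=\sup\{\mathrm{pd}_A(M) : \mathrm{pd}_A(M)<\infty\},\qquad \mathrm{FFD}(A)=\sup\{\mathrm{fd}_A(M) : \mathrm{fd}_A(M)<\infty\},$$ where $M$ ranges over $A$-modules. A ring is perfect if all its flat modules are projective. Let $V=\mathbb{Q}[X]_{(X)}$ be the localization of $\mathbb{Q}[X]$ at the prime ideal $(X)$, and let $R=\mathbb{Z}+XV\subset V$. Then for every perfect ring $S$ of infinite weak dimension, $$\mathrm{cot.D}(S\times R)=1,\qquad \mathrm{FPD}(S\times R)=2,\qquad \mathrm{FFD}(S\times R)=1,\qquad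 \mathrm{wdim}(S\times R)=\infty .$$ In particular $\mathrm{cot.D}(S\times R)<\mathrm{FPD}(S\times R)=\mathrm{cot.D}(S\times R)+\mathrm{FFD}(S\times R)$, so the upper bound in the inequality $\mathrm{FPD}(A)\le \mathrm{cot.D}(A)+\mathrm{FFD}(A)$ is attained by $A=S\times R$. -/

import Mathlib

open CategoryTheory

universe u

noncomputable section

namespace HomDim

section Dimensions

variable {R : Type u} [CommRing R]

/-- The classical projective dimension of a module, as an element of `ℕ ∪ {∞}`.  Mathlib gives
the zero module the dimension `⊥`; here it has dimension `0`. -/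
def projDim (M : ModuleCat.{u} R) : ℕ∞ := (projectiveDimension M).unbotD 0

/-- `HasFlatDimLE n M`: there is an exact sequence `0 → Fₙ → ⋯ → F₁ → F₀ → M → 0` with all `Fᵢ`
flat.  For `n + 1` such a sequence is a surjection `F₀ → M` from a flat module together with a
sequence of length `n` that resolves its kernel. -/
def HasFlatDimLE : ℕ → ModuleCat.{u} R → Prop
  | 0, M => Module.Flat R M
  | n + 1, M => ∃ (F : ModuleCat.{u} R) (p : F →ₗ[R] M), Module.Flat R F ∧
      Function.Surjective p ∧ HasFlatDimLE n (ModuleCat.of R (LinearMap.ker p))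

/-- The flat dimension of a module: the least `n` for which it has a flat resolution of
length `n`, and `∞` if there is none. -/
def flatDim (M : ModuleCat.{u} R) : ℕ∞ :=
  ⨅ (n : ℕ) (_ : HasFlatDimLE n M), (n : ℕ∞)

/-- The cotorsion dimension of a module `M`: the least `n ≥ 0` for which
`Ext^(n+1) (F, M) = 0` for all flat modules `F`, and `∞` if there is none. -/
def cotorsionDim (M : ModuleCat.{u} R) : ℕ∞ :=
  ⨅ (n : ℕ) (_ : ∀ F : ModuleCat.{u} R, Module.Flat R F →
    Subsingleton (Abelian.Ext.{u} F M (n + 1))), (n : ℕ∞)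

variable (R)

/-- A ring is perfect if every flat module is projective. -/
def IsPerfect : Prop :=
  ∀ M : ModuleCat.{u} R, Module.Flat R M → Module.Projective R M

/-- The weak (global) dimension of a ring. -/
def weakDim : ℕ∞ := ⨆ M : ModuleCat.{u} R, flatDim M

/-- The global cotorsion dimension `cot.D(R)`. -/
def globalCotorsionDim : ℕ∞ := ⨆ M : ModuleCat.{u} R, cotorsionDim M

/-- The finitistic projective dimension `FPD(R)`: the supremum of the projective dimensions of
the modules of finite projective dimension. -/
def FPD : ℕ∞ := ⨆ (M : ModuleCat.{u} R) (_ : projDim M < ⊤), projDim M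

/-- The finitistic flat dimension `FFD(R)`: the supremum of the flat dimensions of
the modules of finite flat dimension. -/
def FFD : ℕ∞ := ⨆ (M : ModuleCat.{u} R) (_ : flatDim M < ⊤), flatDim M

end Dimensions

section Ring

open Polynomial

instance isPrime_span_X : (Ideal.span {(X : ℚ[X])}).IsPrime :=
  (Ideal.span_singleton_prime X_ne_zero).2 prime_X

/-- The discrete valuation domain `V = ℚ[X]_(X)`. -/
abbrev V : Type := Localization.AtPrime (Ideal.span {(X : ℚ[X])})

/-- The image of the indeterminate in `V`. -/
def x : V := algebraMap ℚ[X] V X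

/-- The subring `ℤ + XV` of `V = ℚ[X]_(X)`. -/
def intAddXV : Subring V where
  carrier := {v | ∃ (n : ℤ) (w : V), v = n + x * w}
  mul_mem' := by
    rintro _ _ ⟨n, w, rfl⟩ ⟨m, z, rfl⟩
    exact ⟨n * m, n * z + m * w + x * w * z, by push_cast; ring⟩
  one_mem' := ⟨1, 0, by simp⟩
  add_mem' := by
    rintro _ _ ⟨n, w, rfl⟩ ⟨m, z, rfl⟩
    exact ⟨n + m, w + z, by push_cast; ring⟩
  zero_mem' := ⟨0, 0, by simp⟩
  neg_mem' := by
    rintro _ ⟨n, w, rfl⟩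
    exact ⟨-n, -w, by push_cast; ring⟩

end Ring

end HomDim

end

/-! Write A = S × R with R = ℤ + XV. Flatness and projectivity over A follow from the same
properties of the base changes to S and R, and kernels commute with these flat base changes, so each
factor can be treated alone.

Over the perfect ring S, projectivity of Bass's modules gives the descending chain condition on
principal ideals. Hence a projective submodule of a projective module is pure, and every module of
finite flat dimension is flat, hence projective (`PrincipalDCC.flat_of_hasFlatDimLE`).

R is a Bézout domain, so flat means torsion-free and submodules of flat modules are flat. Moreover
the kernel of a map from a free module to a torsion-free one is free (`IsIntegerPreimage.free_ker`):
its saturation over V is free with reduction embedded in ℚ^(ι), and the kernel is cut out by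
integrality of that reduction, a condition that becomes coordinatewise after a change of basis over
ℚ.

So over A the first syzygy of a module of finite flat dimension is flat (`flat_ker`), and that of a
flat module is projective (`projective_ker`). This gives the upper bounds 1, 2, 1. They are attained
because I = 0 × XV is flat but not projective: I bounds cot.D from below, and A/I has flat dimension
1 and projective dimension 2. The factor S makes the weak dimension infinite. -/

noncomputable section

namespace HomDim

/-! ### Perfect rings: finite flat dimension forces flatness -/

section Perfect

open Filter

variable {S : Type u} [CommRing S]

/-- The colimit of `S → S → S → ⋯`, where the maps are the multiplications by the `b n`, realised
as a module of germs of sequences. -/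
def bassModule (b : ℕ → S) : Submodule S (Germ (atTop : Filter ℕ) S) where
  carrier := {y | ∃ f : ℕ → S, (f : Germ atTop S) = y ∧ ∀ᶠ m in atTop, f (m + 1) = b m * f m}
  add_mem' := by
    rintro _ _ ⟨f, rfl, hf⟩ ⟨g, rfl, hg⟩
    refine ⟨f + g, rfl, ?_⟩
    filter_upwards [hf, hg] with m h₁ h₂
    simp only [Pi.add_apply, h₁, h₂, mul_add]
  zero_mem' := ⟨0, rfl, by simp⟩
  smul_mem' := by
    rintro c _ ⟨f, rfl, hf⟩
    refine ⟨c • f, rfl, ?_⟩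
    filter_upwards [hf] with m h
    simp only [Pi.smul_apply, h, smul_eq_mul, mul_left_comm]

/-- The image in the colimit of the unit of the `n`-th copy of `S`. -/
def bassModule.gen (b : ℕ → S) (n : ℕ) : bassModule b :=
  ⟨((fun m ↦ ∏ i ∈ Finset.Ico n m, b i : ℕ → S) : Germ atTop S), _, rfl, by
    filter_upwards [eventually_ge_atTop n] with m hm
    rw [Finset.prod_Ico_succ_top hm, mul_comm]⟩

namespace bassModule

variable (b : ℕ → S)

lemma gen_eq_smul {n m : ℕ} (h : n ≤ m) : gen b n = (∏ i ∈ Finset.Ico n m, b i) • gen b m := by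
  refine Subtype.ext (Germ.coe_eq.2 ?_)
  filter_upwards [eventually_ge_atTop m] with k hk
  exact (Finset.prod_Ico_consecutive b h hk).symm

lemma eventually_mem_span_gen (y : bassModule b) :
    ∀ᶠ n in atTop, ∃ c : S, y = c • gen b n := by
  obtain ⟨_, f, rfl, hf⟩ := y
  obtain ⟨N, hN⟩ := eventually_atTop.1 hf
  filter_upwards [eventually_ge_atTop N] with n hn
  refine ⟨f n, Subtype.ext (Germ.coe_eq.2 ?_)⟩
  filter_upwards [eventually_ge_atTop n] with m hm
  change f m = f n * ∏ i ∈ Finset.Ico n m, b i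
  induction m, hm using Nat.le_induction with
  | base => simp
  | succ m hm ih => rw [hN m (hn.trans hm), ih, Finset.prod_Ico_succ_top hm]; ring

lemma eventually_mul_prod_eq {c d : S} {n : ℕ} (h : c • gen b n = d • gen b n) :
    ∀ᶠ m in atTop, c * ∏ i ∈ Finset.Ico n m, b i = d * ∏ i ∈ Finset.Ico n m, b i :=
  Germ.coe_eq.1 (congrArg Subtype.val h)

/-- Equational criterion: finitely many elements are multiples of a single generator, and a relation
between them already holds for the coefficients at some later stage. -/
instance flat : Module.Flat S (bassModule b) := by
  refine Module.Flat.of_forall_isTrivialRelation fun {l f y} h ↦ ?_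
  obtain ⟨n, hn⟩ := (eventually_all.2 fun i ↦ eventually_mem_span_gen b (y i)).exists
  choose c hc using hn
  have h0 : (∑ i, f i * c i) • gen b n = (0 : S) • gen b n := by
    rw [zero_smul, ← h, Finset.sum_smul]
    exact Finset.sum_congr rfl fun i _ ↦ by rw [hc i, smul_smul]
  obtain ⟨m, hm, hnm⟩ :=
    ((eventually_mul_prod_eq b h0).and (eventually_ge_atTop n)).exists
  refine ⟨1, fun i _ ↦ c i * ∏ i ∈ Finset.Ico n m, b i, fun _ ↦ gen b m, ?_, ?_⟩
  · intro i
    rw [hc i, gen_eq_smul b hnm, smul_smul]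
    simp
  · intro _
    simp only [← mul_assoc, ← Finset.sum_mul, hm, zero_mul]

/-- If the colimit is projective, then the chain of the ideals generated by the products
`b 0 * ⋯ * b (n - 1)` is stationary. -/
lemma exists_prod_dvd_prod [Module.Projective S (bassModule b)] :
    ∃ n, ∏ i ∈ Finset.range (n + 1), b i ∣ ∏ i ∈ Finset.range n, b i := by
  obtain ⟨s, hs⟩ := Module.projective_def'.1 ‹Module.Projective S (bassModule b)›
  have hsum := LinearMap.congr_fun hs (gen b 0)
  obtain ⟨n, hn⟩ := ((eventually_all_finset (s (gen b 0)).support).2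
    fun y _ ↦ eventually_mem_span_gen b y).exists
  choose! c hc using hn
  have h0 : (∏ i ∈ Finset.Ico 0 n, b i) • gen b n = (∑ y ∈ (s (gen b 0)).support, s (gen b 0) y * c y) • gen b n := by
    rw [← gen_eq_smul b (Nat.zero_le n), Finset.sum_smul]
    refine hsum.symm.trans ?_
    rw [LinearMap.comp_apply, Finsupp.linearCombination_apply, Finsupp.sum]
    refine Finset.sum_congr rfl fun y hy ↦ ?_
    rw [mul_smul, ← hc y hy, id]
  obtain ⟨m, hm, hnm⟩ :=
    ((eventually_mul_prod_eq b h0).and (eventually_ge_atTop n)).exists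
  refine ⟨m, ?_⟩
  rw [Finset.prod_Ico_consecutive b (Nat.zero_le n) hnm] at hm
  rw [Finset.range_eq_Ico, Finset.range_eq_Ico, hm]
  -- Each coordinate of `s (gen b 0)` is divisible by the longer product, since `gen b 0` is that
  -- product times `gen b (m + 1)`.
  refine (Finset.dvd_sum fun y _ ↦ ?_).mul_right _
  refine Dvd.dvd.mul_right ?_ _
  rw [gen_eq_smul b (Nat.zero_le (m + 1)), map_smul]
  exact dvd_mul_right _ _

end bassModule

/-- The descending chain condition on principal ideals. -/
def PrincipalDCC (S : Type u) [CommRing S] : Prop :=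
  ∀ b : ℕ → S, ∃ n, ∏ i ∈ Finset.range (n + 1), b i ∣ ∏ i ∈ Finset.range n, b i

lemma IsPerfect.principalDCC (hS : IsPerfect S) : PrincipalDCC S := fun b ↦
  have : Module.Projective S (bassModule b) :=
    hS (ModuleCat.of S (bassModule b)) (bassModule.flat b)
  bassModule.exists_prod_dvd_prod b

namespace PrincipalDCC

variable (hS : PrincipalDCC S)
include hS

lemma exists_minimal (p : S → Prop) {a₀ : S} (h₀ : p a₀) :
    ∃ a, p a ∧ ∀ c, p (a * c) → a * c ∣ a := by
  by_contra! H
  choose! c hc hdvd using H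
  let a : ℕ → S := fun n ↦ Nat.rec a₀ (fun _ a ↦ a * c a) n
  have ha : ∀ n, p (a n) := fun n ↦ by
    induction n with
    | zero => exact h₀
    | succ n ih => exact hc _ ih
  have hprod : ∀ n, a n = a₀ * ∏ i ∈ Finset.range n, c (a i) := fun n ↦ by
    induction n with
    | zero => simp [a]
    | succ n ih =>
      rw [Finset.prod_range_succ, ← mul_assoc, ← ih]
  obtain ⟨n, hn⟩ := hS fun i ↦ c (a i)
  refine hdvd (a n) (ha n) ?_
  change a (n + 1) ∣ a n
  have := mul_dvd_mul_left a₀ hn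
  rwa [← hprod, ← hprod] at this

/-- Take a outside J minimal for divisibility. If ar ∉ J, then a = ard for some d, so 1 - rd lies in
the colon ideal (J : a), which is therefore maximal. -/
lemma exists_isMaximal_colon {J : Ideal S} (hJ : J ≠ ⊤) :
    ∃ a ∉ J, ∃ m : Ideal S, m.IsMaximal ∧ ∀ r, r ∈ m ↔ a * r ∈ J := by
  obtain ⟨a, ha, hmin⟩ := hS.exists_minimal (· ∉ J) ((Ideal.ne_top_iff_one J).1 hJ)
  refine ⟨a, ha, Submodule.comap (LinearMap.mul S S a) J, ?_, fun r ↦ Iff.rfl⟩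
  refine Ideal.isMaximal_iff.2 ⟨by simpa using ha, fun I r hI hr hrI ↦ ?_⟩
  obtain ⟨d, hd⟩ := hmin r hr
  have h1 : 1 - r * d ∈ I := hI <| by
    have : a * (1 - r * d) = 0 := by rw [mul_sub, mul_one, ← mul_assoc, ← hd, sub_self]
    simp [this]
  simpa using I.add_mem h1 (I.mul_mem_right d hrI)

lemma exists_eq_annihilator {m : Ideal S} (hm : m.IsMaximal) :
    ∃ s : S, ∀ r, r ∈ m ↔ s * r = 0 := by
  obtain ⟨a, ha, hmin⟩ := hS.exists_minimal (· ∉ m) ((Ideal.ne_top_iff_one m).1 hm.ne_top)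
  have hJ : LinearMap.ker (LinearMap.mul S S a) ≠ ⊤ := by
    refine (Ideal.ne_top_iff_one _).2 fun h ↦ ha ?_
    have : a = 0 := by simpa using h
    simp [this]
  obtain ⟨t, ht, n, hn, hnt⟩ := hS.exists_isMaximal_colon hJ
  -- An r in n outside m would give a = ard, hence at = (atr)d = 0. So m is the annihilator of at.
  have hnm : n = m := by
    refine hn.eq_of_le hm.ne_top fun r hr ↦ ?_
    by_contra hrm
    obtain ⟨d, hd⟩ := hmin r fun h ↦ (hm.isPrime.mem_or_mem h).elim ha hrm
    refine ht ?_
    have h : a * (t * r) = 0 := (hnt r).1 hr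
    change a * t = 0
    calc a * t = a * r * d * t := by rw [← hd]
      _ = a * (t * r) * d := by ring
      _ = 0 := by rw [h, zero_mul]
  subst hnm
  exact ⟨a * t, fun r ↦ (hnt r).trans (by simp [mul_assoc])⟩

end PrincipalDCC

/-- An element of a projective module lies in `I • P` if all its coordinates lie in `I`. -/
lemma mem_smul_top_of_forall_dual {R P : Type*} [CommRing R] [AddCommGroup P] [Module R P]
    [Module.Projective R P] {I : Ideal R} {p : P} (h : ∀ φ : P →ₗ[R] R, φ p ∈ I) :
    p ∈ I • (⊤ : Submodule R P) := by
  obtain ⟨s, hs⟩ := Module.projective_def'.1 ‹Module.Projective R P›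
  have hp := LinearMap.congr_fun hs p
  rw [LinearMap.comp_apply, Finsupp.linearCombination_apply, LinearMap.id_apply] at hp
  rw [← hp]
  exact Submodule.sum_mem _ fun y _ ↦
    Submodule.smul_mem_smul (h (Finsupp.lapply y ∘ₗ s)) Submodule.mem_top

lemma dual_mem_of_mem_smul_top {R P : Type*} [CommRing R] [AddCommGroup P] [Module R P]
    {I : Ideal R} {p : P} (h : p ∈ I • (⊤ : Submodule R P)) (φ : P →ₗ[R] R) : φ p ∈ I := by
  refine Submodule.smul_induction_on h (fun r hr n _ ↦ ?_) fun x y hx hy ↦ ?_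
  · rw [map_smul, smul_eq_mul]
    exact I.mul_mem_right _ hr
  · rw [map_add]
    exact I.add_mem hx hy

variable {F : Type*} [AddCommGroup F] [Module S F]

/-- Over a ring with the descending chain condition on principal ideals, a projective submodule of
a projective module is a pure submodule. -/
lemma PrincipalDCC.mem_smul_top (hS : PrincipalDCC S) [Module.Projective S F] (K : Submodule S F)
    [Module.Projective S K] (I : Ideal S) (p : K) (hp : (p : F) ∈ I • (⊤ : Submodule S F)) :
    p ∈ I • (⊤ : Submodule S K) := by
  by_contra hpI
  -- Enlarge I to J maximal with p ∉ JK. With m = (J : a) maximal, p = w + aq where w ∈ JK; it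
  -- remains to show q ∈ mK, for then aq ∈ JK.
  obtain ⟨J, hIJ, hJ⟩ := zorn_le_nonempty₀ {J : Ideal S | p ∉ J • (⊤ : Submodule S K)} (by
    intro C hC hchain J₀ hJ₀
    refine ⟨sSup C, fun h ↦ ?_, fun J hJ ↦ le_sSup hJ⟩
    rw [sSup_eq_iSup', Submodule.iSup_smul] at h
    have : Nonempty C := ⟨⟨J₀, hJ₀⟩⟩
    rw [Submodule.mem_iSup_of_directed] at h
    · obtain ⟨J, hJ⟩ := h
      exact hC J.2 hJ
    · intro J₁ J₂
      obtain h | h := hchain.total J₁.2 J₂.2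
      · exact ⟨J₂, Submodule.smul_mono_left h, le_rfl⟩
      · exact ⟨J₁, le_rfl, Submodule.smul_mono_left h⟩) I hpI
  have hJtop : J ≠ ⊤ := by
    rintro rfl
    exact hJ.prop (by simp)
  obtain ⟨a, haJ, m, hm, hmJ⟩ := hS.exists_isMaximal_colon hJtop
  obtain ⟨s, hs⟩ := hS.exists_eq_annihilator hm
  have hsup : p ∈ (J ⊔ Ideal.span {a}) • (⊤ : Submodule S K) := by
    by_contra h
    exact haJ (hJ.le_of_ge h le_sup_left (Ideal.mem_sup_right (Ideal.mem_span_singleton_self a)))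
  rw [Submodule.sup_smul, Submodule.mem_sup] at hsup
  obtain ⟨w, hw, z, hz, hwz⟩ := hsup
  rw [Submodule.ideal_span_singleton_smul, Submodule.mem_smul_pointwise_iff_exists] at hz
  obtain ⟨q, -, rfl⟩ := hz
  have hle : (J • (⊤ : Submodule S K)).map K.subtype ≤ J • ⊤ := by
    rw [Submodule.map_smul'']
    exact Submodule.smul_mono le_rfl le_top
  have haq : a • (q : F) ∈ J • (⊤ : Submodule S F) := by
    have h1 := Submodule.smul_mono_left (N := (⊤ : Submodule S F)) hIJ hp
    have h2 := hle (Submodule.mem_map_of_mem hw)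
    have h3 : a • (q : F) = p - K.subtype w := by
      rw [← hwz]; simp
    rw [h3]
    exact sub_mem h1 h2
  have hqF : (q : F) ∈ m • (⊤ : Submodule S F) := mem_smul_top_of_forall_dual fun φ ↦ by
    rw [hmJ, ← smul_eq_mul, ← map_smul]
    exact dual_mem_of_mem_smul_top haq φ
  -- The equation sq = 0 carries information from F to K: since m is the annihilator of s, it puts
  -- the coordinates of q in the projective module K into m.
  have hsq : s • q = 0 := by
    refine Subtype.ext ?_
    change s • (q : F) = 0
    refine Submodule.smul_induction_on hqF (fun r hr n _ ↦ ?_) fun x y hx hy ↦ ?_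
    · rw [smul_smul, (hs r).1 hr, zero_smul]
    · rw [smul_add, hx, hy, add_zero]
  have hqK : q ∈ m • (⊤ : Submodule S K) := mem_smul_top_of_forall_dual fun φ ↦ by
    rw [hs, ← smul_eq_mul, ← map_smul, hsq, map_zero]
  refine hJ.prop ?_
  rw [← hwz]
  refine add_mem hw ?_
  refine Submodule.smul_induction_on (p := fun q ↦ a • q ∈ J • (⊤ : Submodule S K)) hqK
    (fun r hr n hn ↦ ?_) fun x y hx hy ↦ ?_
  · rw [smul_smul]
    exact Submodule.smul_mem_smul ((hmJ r).1 hr) hn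
  · rw [smul_add]
    exact add_mem hx hy

open TensorProduct in
/-- The quotient of a flat module by a pure submodule is flat. -/
lemma flat_of_surjective_of_pure {R F M : Type*} [CommRing R] [AddCommGroup F] [Module R F]
    [AddCommGroup M] [Module R M] [Module.Flat R F] (f : F →ₗ[R] M) (hf : Function.Surjective f)
    (h : ∀ (I : Ideal R) (p : LinearMap.ker f), (p : F) ∈ I • (⊤ : Submodule R F) →
      p ∈ I • (⊤ : Submodule R (LinearMap.ker f))) : Module.Flat R M := by
  refine Module.Flat.iff_lift_lsmul_comp_subtype_injective.2 fun I _ ↦ ?_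
  refine (injective_iff_map_eq_zero _).2 fun z hz ↦ ?_
  obtain ⟨y, rfl⟩ := LinearMap.lTensor_surjective I hf z
  let μ := TensorProduct.lift ((LinearMap.lsmul R F).comp I.subtype)
  have hμ : Function.Injective μ :=
    Module.Flat.iff_lift_lsmul_comp_subtype_injective.1 ‹_› ‹_›
  have hker : f (μ y) = 0 := by
    rw [← hz]
    refine LinearMap.congr_fun (f := f ∘ₗ μ) (g := TensorProduct.lift _ ∘ₗ _)
      (TensorProduct.ext' fun a b ↦ ?_) y
    simp [μ]
  have hmem : μ y ∈ I • (⊤ : Submodule R F) := by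
    clear hz hker
    induction y with
    | zero => simp
    | tmul a b => exact Submodule.smul_mem_smul a.2 Submodule.mem_top
    | add a b ha hb => rw [map_add]; exact add_mem ha hb
  have hrange : ∀ p ∈ I • (⊤ : Submodule R (LinearMap.ker f)),
      ∃ w : I ⊗[R] LinearMap.ker f, μ ((LinearMap.ker f).subtype.lTensor I w) = p := by
    intro p hp
    refine Submodule.smul_induction_on hp (fun r hr n _ ↦ ⟨⟨r, hr⟩ ⊗ₜ n, by simp [μ]⟩) ?_
    rintro _ _ ⟨w, hw⟩ ⟨w', hw'⟩
    exact ⟨w + w', by simp [hw, hw']⟩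
  -- By purity and injectivity of μ, y comes from I ⊗ ker f, so it dies in I ⊗ M.
  obtain ⟨w, hw⟩ := hrange ⟨μ y, hker⟩ (h I ⟨μ y, hker⟩ hmem)
  rw [← hμ hw, ← LinearMap.comp_apply, ← LinearMap.lTensor_comp]
  have : f ∘ₗ (LinearMap.ker f).subtype = 0 := by ext; simp
  simp [this]

lemma PrincipalDCC.flat_of_hasFlatDimLE (hS : PrincipalDCC S) (hS' : IsPerfect S) (n : ℕ)
    (M : ModuleCat.{u} S) (hM : HasFlatDimLE n M) : Module.Flat S M := by
  induction n generalizing M with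
  | zero => exact hM
  | succ n ih =>
    obtain ⟨F, f, hF, hf, hK⟩ := hM
    have := hS' F hF
    have := hS' _ (ih _ hK)
    exact flat_of_surjective_of_pure f hf fun I p hp ↦ by
      exact hS.mem_smul_top (LinearMap.ker f) I p hp

end Perfect

/-! ### Submodules of free modules over a principal ideal domain -/

section Free

variable {R : Type*} [CommRing R] [IsDomain R] [IsPrincipalIdealRing R]

/-- A submodule of a free module over a principal ideal domain is free. -/
lemma free_of_injective {ι N : Type*} [AddCommGroup N] [Module R N] (f : N →ₗ[R] ι →₀ R)
    (hf : Function.Injective f) : Module.Free R N := by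
  obtain ⟨_, _⟩ := exists_wellFoundedLT ι
  -- For a well-order on ι, `I i` is the ideal of coefficients at i of elements supported up to i.
  -- Elements realising its generators, where nonzero, form the basis.
  let D (i : ι) : Submodule R N := (Finsupp.supported R R (Set.Iic i)).comap f
  let I (i : ι) : Ideal R := (D i).map (Finsupp.lapply i ∘ₗ f)
  have hgen (i : ι) : ∃ n ∈ D i, f n i = Submodule.IsPrincipal.generator (I i) :=
    Submodule.IsPrincipal.generator_mem (I i)
  choose n hnD hn using hgen
  let τ := {i // f (n i) i ≠ 0}
  have hvan {i j : ι} (h : i < j) : f (n i) j = 0 :=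
    (Finsupp.mem_supported' R (f (n i))).1 (hnD i) j (not_le.2 h)
  let g (i : τ) : N := n i
  have hli : LinearIndependent R g := by
    rw [linearIndependent_iff]
    intro l hl
    by_contra hne
    have hsupp := Finsupp.support_nonempty_iff.2 hne
    obtain ⟨i, hi, hmax⟩ := l.support.exists_max_image (fun i ↦ (i : ι)) hsupp
    have h0 : ∑ j ∈ l.support, l j * f (n j) i = 0 := by
      have h := congrArg (fun z ↦ f z i) hl
      simpa [Finsupp.linearCombination_apply, Finsupp.sum, g] using h
    rw [Finset.sum_eq_single_of_mem i hi fun j hj hji ↦ by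
      rw [hvan ((hmax j hj).lt_of_ne fun h ↦ hji (Subtype.ext h)), mul_zero]] at h0
    exact (mul_ne_zero (Finsupp.mem_support_iff.1 hi) i.2) h0
  have hsupp {z : N} (hz : z ≠ 0) : (f z).support.Nonempty :=
    Finsupp.support_nonempty_iff.2 ((map_ne_zero_iff f hf).2 hz)
  have hspan : ∀ i, ∀ z ∈ D i, z ∈ Submodule.span R (Set.range g) := by
    intro i
    induction i using WellFoundedLT.induction with
    | _ i ih =>
    intro z hz
    have hlt : ∀ y ∈ D i, f y i = 0 → y ∈ Submodule.span R (Set.range g) := by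
      intro y hy hyi
      by_cases hy0 : y = 0
      · rw [hy0]; exact zero_mem _
      have hmem := Finset.max'_mem _ (hsupp hy0)
      refine ih (Finset.max' _ (hsupp hy0)) (lt_of_le_of_ne (hy hmem) fun h ↦ ?_) y
        fun j hj ↦ Finset.le_max' _ _ hj
      rw [h] at hmem
      exact Finsupp.mem_support_iff.1 hmem hyi
    have hzI : f z i ∈ I i := ⟨z, hz, rfl⟩
    rw [← Submodule.IsPrincipal.span_singleton_generator (I i), ← hn i] at hzI
    obtain ⟨c, hc⟩ := Submodule.mem_span_singleton.1 hzI
    rw [smul_eq_mul] at hc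
    by_cases hi : f (n i) i = 0
    · exact hlt z hz (by rw [← hc, hi, mul_zero])
    · have h := hlt (z - c • n i) (sub_mem hz (Submodule.smul_mem _ _ (hnD i))) (by simp [← hc])
      rw [← sub_add_cancel z (c • n i)]
      exact add_mem h (Submodule.smul_mem _ _ (Submodule.subset_span ⟨⟨i, hi⟩, rfl⟩))
  refine Module.Free.of_basis (Module.Basis.mk hli fun z _ ↦ ?_)
  by_cases hz0 : z = 0
  · rw [hz0]; exact zero_mem _
  exact hspan (Finset.max' _ (hsupp hz0)) z fun j hj ↦ Finset.le_max' _ _ hj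

end Free

/-! ### The ring ℤ + XV is Bézout -/

section Ring

open Polynomial

lemma notMem_span_X_iff {p : ℚ[X]} : p ∉ Ideal.span {(X : ℚ[X])} ↔ p.eval 0 ≠ 0 := by
  rw [Ideal.mem_span_singleton, X_dvd_iff, coeff_zero_eq_eval_zero]

/-- The residue map `V → ℚ`. -/
def residue : V →+* ℚ :=
  IsLocalization.lift (M := (Ideal.span {(X : ℚ[X])}).primeCompl) (g := evalRingHom 0)
    fun s ↦ (notMem_span_X_iff.1 s.2).isUnit

lemma residue_algebraMap (p : ℚ[X]) : residue (algebraMap ℚ[X] V p) = p.eval 0 :=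
  IsLocalization.lift_eq _ p

@[simp] lemma residue_x : residue x = 0 := by simp [x, residue_algebraMap]

@[simp] lemma residue_rat (q : ℚ) : residue (algebraMap ℚ V q) = q := by
  rw [IsScalarTower.algebraMap_apply ℚ ℚ[X] V, residue_algebraMap]
  simp

lemma exists_eq_x_mul {v : V} (h : residue v = 0) : ∃ w, v = x * w := by
  obtain ⟨p, s, rfl⟩ := IsLocalization.exists_mk'_eq (Ideal.span {(X : ℚ[X])}).primeCompl v
  have hp : p.eval 0 = 0 := by
    rw [← residue_algebraMap, ← IsLocalization.mk'_spec V p s, map_mul, h, zero_mul]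
  have hp' : p ∈ Ideal.span {(X : ℚ[X])} := by
    by_contra hc
    exact notMem_span_X_iff.1 hc hp
  obtain ⟨q, rfl⟩ := Ideal.mem_span_singleton.1 hp'
  exact ⟨IsLocalization.mk' V q s, by rw [x, IsLocalization.mul_mk'_eq_mk'_of_mul]⟩

lemma mem_intAddXV {v : V} : v ∈ intAddXV ↔ ∃ n : ℤ, residue v = n := by
  constructor
  · rintro ⟨n, w, rfl⟩
    exact ⟨n, by simp⟩
  · rintro ⟨n, hn⟩
    obtain ⟨w, hw⟩ := exists_eq_x_mul (v := v - n) (by simp [hn])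
    exact ⟨n, w, by rw [← hw]; ring⟩

lemma x_mul_mem (w : V) : x * w ∈ intAddXV := mem_intAddXV.2 ⟨0, by simp⟩

lemma x_ne_zero : x ≠ 0 := by
  have h : Function.Injective (algebraMap ℚ[X] V) :=
    IsLocalization.injective V (Ideal.span {(X : ℚ[X])}).primeCompl_le_nonZeroDivisors
  exact (map_ne_zero_iff _ h).2 X_ne_zero

instance : IsDiscreteValuationRing V :=
  IsLocalization.AtPrime.isDiscreteValuationRing_of_dedekind_domain ℚ[X]
    (P := Ideal.span {(X : ℚ[X])}) (by simp) V

lemma algebraMap_rat_natCast (n : ℕ) : algebraMap ℚ V n = n := map_natCast _ n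

instance : IsBezout intAddXV := by
  rw [IsBezout.iff_span_pair_isPrincipal]
  suffices H : ∀ (a b : intAddXV) (v : V), (b : V) = a * v →
      (Ideal.span {a, b}).IsPrincipal by
    intro a b
    obtain ⟨v, hv⟩ | ⟨v, hv⟩ := ValuationRing.dvd_total (a : V) b
    · exact H a b v hv
    · rw [Set.pair_comm]
      exact H b a v hv
  intro a b v hv
  -- If v has residue q in lowest terms, the ideal (a, av) is generated by a divided by the
  -- denominator of q.
  obtain ⟨w, hw⟩ := exists_eq_x_mul (v := v - algebraMap ℚ V (residue v)) (by simp)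
  set q := residue v with hq
  obtain ⟨s, t, hst⟩ : IsCoprime q.num (q.den : ℤ) :=
    Int.isCoprime_iff_gcd_eq_one.2 q.reduced
  have hst' := congrArg (algebraMap ℚ V ∘ Int.cast) hst
  have hd : (q.den : V) * algebraMap ℚ V (q.den : ℚ)⁻¹ = 1 := by
    rw [← algebraMap_rat_natCast, ← map_mul, mul_inv_cancel₀ (by simp [q.den_ne_zero]), map_one]
  have hn : algebraMap ℚ V q = q.num * algebraMap ℚ V (q.den : ℚ)⁻¹ := by
    conv_lhs => rw [← Rat.num_div_den q, div_eq_mul_inv, map_mul, map_intCast]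
  simp only [Function.comp_apply, Int.cast_add, Int.cast_mul, Int.cast_natCast, map_add, map_mul,
    map_intCast, map_natCast, Int.cast_one, map_one] at hst'
  set i := algebraMap ℚ V (q.den : ℚ)⁻¹
  have hv' : v = q.num * i + x * w := by rw [← hn, ← hw]; ring
  have hg : (a : V) * i = t * a + s * b - a * (x * (s * w)) := by
    rw [hv, hv']
    linear_combination (-(a : V) * i) * hst' + (t * a : V) * hd
  have hgmem : (a : V) * i ∈ intAddXV := by
    rw [hg]
    exact sub_mem (add_mem (mul_mem (intCast_mem _ _) a.2) (mul_mem (intCast_mem _ _) b.2))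
      (mul_mem a.2 (x_mul_mem _))
  refine ⟨⟨a * i, hgmem⟩, le_antisymm ?_ ?_⟩
  · rw [Ideal.span_le]
    rintro y (hy | hy) <;> rw [hy]
    · refine Submodule.mem_span_singleton.2 ⟨q.den, Subtype.ext ?_⟩
      simp
      linear_combination (a : V) * hd
    · refine Submodule.mem_span_singleton.2 ⟨q.num + ⟨x * (q.den * w), x_mul_mem _⟩, Subtype.ext ?_⟩
      simp [hv, hv']
      linear_combination (a * x * w : V) * hd
  · rw [Submodule.span_singleton_le_iff_mem]
    refine Ideal.mem_span_pair.2 ⟨t - ⟨x * (s * w), x_mul_mem _⟩, s, Subtype.ext ?_⟩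
    simp [hg]
    ring

end Ring

/-! ### Rational lattices and freeness of kernels over preimages of ℤ -/

section Ring

/-- A vector with rational coordinates is integral if its coordinates are integers. -/
def IsIntegralVec {ι : Type*} (u : ι →₀ ℚ) : Prop := ∀ i, ∃ n : ℤ, u i = n

/-- The lattice of the vectors with integral image under a linear map. -/
def integralLattice {κ ι : Type*} (ε : (κ →₀ ℚ) →ₗ[ℚ] ι →₀ ℚ) : Submodule ℤ (κ →₀ ℚ) where
  carrier := {u | IsIntegralVec (ε u)}
  add_mem' := fun {u v} hu hv i ↦ by
    obtain ⟨n, hn⟩ := hu i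
    obtain ⟨m, hm⟩ := hv i
    exact ⟨n + m, by simp [hn, hm]⟩
  zero_mem' := fun i ↦ ⟨0, by simp⟩
  smul_mem' := fun c u hu i ↦ by
    obtain ⟨n, hn⟩ := hu i
    exact ⟨c * n, by simp [hn]⟩

lemma free_integralLattice {κ ι : Type*} (ε : (κ →₀ ℚ) →ₗ[ℚ] ι →₀ ℚ)
    (hε : Function.Injective ε) : Module.Free ℤ (integralLattice ε) := by
  let φ : integralLattice ε →+ (ι →₀ ℤ) :=
    { toFun := fun u ↦ (ε u).mapRange Rat.num rfl
      map_zero' := by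
        ext i
        change (ε ((0 : integralLattice ε) : κ →₀ ℚ) i).num = 0
        simp
      map_add' := fun u v ↦ by
        ext i
        obtain ⟨n, hn⟩ := u.2 i
        obtain ⟨m, hm⟩ := v.2 i
        have h : ε (u + v : integralLattice ε) i = ((n + m : ℤ) : ℚ) := by simp [hn, hm]
        change (ε (u + v : integralLattice ε) i).num = (ε u i).num + (ε v i).num
        rw [hn, hm, h]
        simp only [Rat.num_intCast] }
  refine free_of_injective φ.toIntLinearMap ((injective_iff_map_eq_zero φ).2 fun u hu ↦ ?_)
  refine Subtype.ext (hε ?_)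
  ext i
  have := DFunLike.congr_fun hu i
  have h0 : (ε u i).num = 0 := this
  simpa using h0

lemma exists_nsmul_isIntegralVec {ι : Type*} (u : ι →₀ ℚ) :
    ∃ n : ℕ, n ≠ 0 ∧ IsIntegralVec ((n : ℚ) • u) := by
  refine ⟨∏ i ∈ u.support, (u i).den, Finset.prod_ne_zero_iff.2 fun i _ ↦ (u i).den_ne_zero,
    fun i ↦ ?_⟩
  by_cases hi : i ∈ u.support
  · obtain ⟨d, hd⟩ := Finset.dvd_prod_of_mem (fun i ↦ (u i).den) hi
    refine ⟨d * (u i).num, ?_⟩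
    rw [hd, Finsupp.smul_apply, smul_eq_mul]
    push_cast
    rw [mul_comm ((u i).den : ℚ), mul_assoc, Rat.den_mul_eq_num]
  · exact ⟨0, by simp [Finsupp.notMem_support_iff.1 hi]⟩

/-- The lattice of the vectors with integral image under an injective linear map is the standard
lattice in suitable coordinates. -/
lemma exists_equiv_isIntegralVec {κ : Type u} {ι : Type*} (ε : (κ →₀ ℚ) →ₗ[ℚ] ι →₀ ℚ)
    (hε : Function.Injective ε) : ∃ (τ : Type u) (e : (κ →₀ ℚ) ≃ₗ[ℚ] (τ →₀ ℚ)),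
      ∀ u, IsIntegralVec (ε u) ↔ IsIntegralVec (e u) := by
  have := free_integralLattice ε hε
  let g := Module.Free.chooseBasis ℤ (integralLattice ε)
  -- A ℤ-basis of the lattice is a ℚ-basis of the space: clearing denominators brings every vector
  -- into the lattice.
  have hli : LinearIndependent ℚ fun t ↦ (g t : κ →₀ ℚ) :=
    (LinearIndependent.iff_fractionRing ℤ ℚ).1
      (g.linearIndependent.map' (integralLattice ε).subtype (Submodule.ker_subtype _))
  have hmem (u : integralLattice ε) : (u : κ →₀ ℚ) ∈
      Submodule.span ℚ (Set.range fun t ↦ (g t : κ →₀ ℚ)) := by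
    refine Submodule.span_induction (p := fun (u : integralLattice ε) _ ↦ (u : κ →₀ ℚ) ∈
      Submodule.span ℚ (Set.range fun t ↦ (g t : κ →₀ ℚ))) ?_ ?_ ?_ ?_ (g.mem_span u)
    · rintro _ ⟨t, rfl⟩
      exact Submodule.subset_span ⟨t, rfl⟩
    · exact zero_mem _
    · intro _ _ _ _ h₁ h₂
      exact add_mem h₁ h₂
    · intro c _ _ h
      exact zsmul_mem h c
  let b : Module.Basis _ ℚ (κ →₀ ℚ) := Module.Basis.mk hli fun u _ ↦ by
    obtain ⟨n, hn, hu⟩ := exists_nsmul_isIntegralVec (ε u)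
    rw [← map_smul] at hu
    have hn' : (n : ℚ) ≠ 0 := by exact_mod_cast hn
    rw [← inv_smul_smul₀ hn' u]
    exact Submodule.smul_mem _ _ (hmem ⟨(n : ℚ) • u, hu⟩)
  have hb (t) : b t = g t := Module.Basis.mk_apply _ _ t
  refine ⟨_, b.repr, fun u ↦ ⟨fun hu ↦ ?_, fun hu ↦ ?_⟩⟩
  · refine Submodule.span_induction (p := fun (u : integralLattice ε) _ ↦
      IsIntegralVec (b.repr (u : κ →₀ ℚ))) ?_ ?_ ?_ ?_ (g.mem_span ⟨u, hu⟩)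
    · rintro _ ⟨t, rfl⟩ s
      rw [← hb, b.repr_self]
      classical
      rw [Finsupp.single_apply]
      split_ifs
      · exact ⟨1, by simp⟩
      · exact ⟨0, by simp⟩
    · exact fun _ ↦ ⟨0, by simp⟩
    · intro u v _ _ hu hv i
      obtain ⟨n, hn⟩ := hu i
      obtain ⟨m, hm⟩ := hv i
      exact ⟨n + m, by simp [hn, hm]⟩
    · intro c u _ hu i
      obtain ⟨n, hn⟩ := hu i
      exact ⟨c * n, by simp [hn]⟩
  · change u ∈ integralLattice ε
    rw [← b.linearCombination_repr u, Finsupp.linearCombination_apply]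
    refine Submodule.sum_mem _ fun t _ ↦ ?_
    obtain ⟨n, hn⟩ := hu t
    dsimp only
    rw [hn, hb, Int.cast_smul_eq_zsmul]
    exact Submodule.smul_mem _ _ (g t).2

/-- Let `x` generate the kernel of a ring homomorphism `ρ : V → ℚ`, and let `R` be the preimage
of `ℤ`. -/
structure IsIntegerPreimage {V : Type*} [CommRing V] (ρ : V →+* ℚ) (x : V) (R : Subring V) :
    Prop where
  ne_zero : x ≠ 0
  apply_self : ρ x = 0
  exists_eq_mul : ∀ v, ρ v = 0 → ∃ w, v = x * w
  mem_iff : ∀ v, v ∈ R ↔ ∃ n : ℤ, ρ v = n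

variable {V : Type*} [CommRing V] (ρ : V →+* ℚ) {x : V} (R : Subring V)

lemma IsIntegerPreimage.mul_mem {ρ : V →+* ℚ} {R : Subring V} (h : IsIntegerPreimage ρ x R)
    (w : V) : x * w ∈ R :=
  (h.mem_iff _).2 ⟨0, by simp [h.apply_self]⟩

/-- The inclusion of `R^(ι)` into `V^(ι)`. -/
def inclVec (ι : Type*) : (ι →₀ R) →ₗ[R] ι →₀ V :=
  Finsupp.mapRange.linearMap (Algebra.linearMap R V)

@[simp] lemma inclVec_apply {ι : Type*} (p : ι →₀ R) (i : ι) : inclVec R ι p i = p i := rfl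

lemma inclVec_injective (ι : Type*) : Function.Injective (inclVec R ι) := fun p q h ↦ by
  ext i
  exact DFunLike.congr_fun h i

/-- The reduction `V^(ι) → ℚ^(ι)`. -/
def reduceVec (ι : Type*) : (ι →₀ V) →+ ι →₀ ℚ :=
  Finsupp.mapRange.addMonoidHom ρ.toAddMonoidHom

@[simp] lemma reduceVec_apply {ι : Type*} (z : ι →₀ V) (i : ι) :
    reduceVec ρ ι z i = ρ (z i) := rfl

lemma reduceVec_smul {ι : Type*} (v : V) (z : ι →₀ V) :
    reduceVec ρ ι (v • z) = ρ v • reduceVec ρ ι z := by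
  ext; simp

lemma isIntegralVec_reduceVec_inclVec (h : IsIntegerPreimage ρ x R) {ι : Type*} (p : ι →₀ R) :
    IsIntegralVec (reduceVec ρ ι (inclVec R ι p)) := fun i ↦ (h.mem_iff _).1 (p i).2

lemma exists_inclVec_eq (h : IsIntegerPreimage ρ x R) {ι : Type*} {z : ι →₀ V}
    (hz : IsIntegralVec (reduceVec ρ ι z)) :
    ∃ p, inclVec R ι p = z := by
  classical
  refine ⟨Finsupp.onFinset z.support (fun i ↦ ⟨z i, (h.mem_iff _).2 (hz i)⟩) fun i hi ↦ ?_, ?_⟩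
  · rw [Finsupp.mem_support_iff]
    exact fun h0 ↦ hi (Subtype.ext h0)
  · ext i
    rfl

lemma exists_eq_x_smul [IsDomain V] (h : IsIntegerPreimage ρ x R) {ι : Type*} {z : ι →₀ V}
    (hz : reduceVec ρ ι z = 0) : ∃ w, z = x • w := by
  have h' (i : ι) : ∃ w, z i = x * w := h.exists_eq_mul _ (DFunLike.congr_fun hz i)
  choose w hw using h'
  refine ⟨Finsupp.onFinset z.support w fun i hi ↦ ?_, ?_⟩
  · rw [Finsupp.mem_support_iff, hw]
    exact mul_ne_zero h.ne_zero hi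
  · ext i
    exact hw i

section Kernel

variable [IsDomain V] {ρ R} {ι : Type*} {F : Type*} [AddCommGroup F] [Module R F]

/-- The vectors over `V` with a nonzero multiple in the kernel of `f`. -/
def kerV (h : IsIntegerPreimage ρ x R) (f : (ι →₀ R) →ₗ[R] F) : Submodule V (ι →₀ V) where
  carrier := {z | ∃ r : R, r ≠ 0 ∧ ∃ p, f p = 0 ∧ inclVec R ι p = r • z}
  add_mem' := by
    rintro z z' ⟨r, hr, p, hp, hpz⟩ ⟨r', hr', p', hp', hpz'⟩
    refine ⟨r * r', mul_ne_zero hr hr', r' • p + r • p', by simp [hp, hp'], ?_⟩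
    rw [map_add, map_smul, map_smul, hpz, hpz', smul_smul, smul_smul, smul_add, mul_comm r']
  zero_mem' := ⟨1, one_ne_zero, 0, by simp, by simp⟩
  smul_mem' := by
    rintro v z ⟨r, hr, p, hp, hpz⟩
    -- The factor x brings any scalar of V into R.
    have hx : (⟨x * 1, h.mul_mem 1⟩ : R) ≠ 0 := fun h' ↦
      h.ne_zero (by simpa using congrArg Subtype.val h')
    refine ⟨⟨x * 1, h.mul_mem 1⟩ * r, mul_ne_zero hx hr, (⟨x * v, h.mul_mem v⟩ : R) • p,
      by simp [hp], ?_⟩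
    rw [map_smul, hpz]
    ext i
    simp only [Finsupp.smul_apply, Subring.smul_def, smul_eq_mul, Subring.coe_mul]
    ring

lemma inclVec_mem_kerV (h : IsIntegerPreimage ρ x R) (f : (ι →₀ R) →ₗ[R] F) (p : LinearMap.ker f) :
    inclVec R ι p ∈ kerV h f := ⟨1, one_ne_zero, p, p.2, by rw [one_smul]⟩

lemma mem_kerV_of_x_smul_mem (h : IsIntegerPreimage ρ x R) {f : (ι →₀ R) →ₗ[R] F} {z : ι →₀ V}
    (hz : x • z ∈ kerV h f) : z ∈ kerV h f := by
  obtain ⟨r, hr, p, hp, hpz⟩ := hz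
  have hx : (⟨x * 1, h.mul_mem 1⟩ : R) ≠ 0 := fun h' ↦
    h.ne_zero (by simpa using congrArg Subtype.val h')
  refine ⟨r * ⟨x * 1, h.mul_mem 1⟩, mul_ne_zero hr hx, p, hp, ?_⟩
  rw [hpz]
  ext i
  simp only [Finsupp.smul_apply, Subring.smul_def, smul_eq_mul, Subring.coe_mul]
  ring

/-- Torsion-freeness of F removes the multiplier: the kernel is exactly the part of `kerV` with
integral reduction. -/
lemma exists_ker_of_mem_kerV (h : IsIntegerPreimage ρ x R) [Module.IsTorsionFree R F]
    {f : (ι →₀ R) →ₗ[R] F} {z : ι →₀ V}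
    (hz : z ∈ kerV h f) (hz' : IsIntegralVec (reduceVec ρ ι z)) :
    ∃ p : LinearMap.ker f, inclVec R ι p = z := by
  obtain ⟨p, rfl⟩ := exists_inclVec_eq ρ R h hz'
  obtain ⟨r, hr, q, hq, hqz⟩ := hz
  rw [← map_smul] at hqz
  rw [inclVec_injective R ι hqz, map_smul, smul_eq_zero] at hq
  exact ⟨⟨p, hq.resolve_left hr⟩, rfl⟩

end Kernel

variable [Algebra ℚ V]

variable (V) in
/-- The inclusion of `ℚ^(ι)` into `V^(ι)`. -/
def constVec (ι : Type*) : (ι →₀ ℚ) →ₗ[ℚ] ι →₀ V :=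
  Finsupp.mapRange.linearMap (Algebra.linearMap ℚ V)

@[simp] lemma constVec_apply {ι : Type*} (u : ι →₀ ℚ) (i : ι) :
    constVec V ι u i = algebraMap ℚ V (u i) := rfl

@[simp] lemma reduceVec_constVec {ι : Type*} (u : ι →₀ ℚ) : reduceVec ρ ι (constVec V ι u) = u := by
  ext i
  exact eq_ratCast (ρ.comp (algebraMap ℚ V)) (u i)

variable (V) in
/-- The extension of scalars of a linear map from `ℚ` to `V`. -/
def extendVec {κ τ : Type*} (e : (κ →₀ ℚ) →ₗ[ℚ] τ →₀ ℚ) : (κ →₀ V) →ₗ[V] τ →₀ V :=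
  Finsupp.linearCombination V fun k ↦ constVec V τ (e (Finsupp.single k 1))

lemma constVec_smul {ι : Type*} (q : ℚ) (u : ι →₀ ℚ) :
    constVec V ι (q • u) = algebraMap ℚ V q • constVec V ι u := by
  ext; simp

lemma extendVec_constVec {κ τ : Type*} (e : (κ →₀ ℚ) →ₗ[ℚ] τ →₀ ℚ) (u : κ →₀ ℚ) :
    extendVec V e (constVec V κ u) = constVec V τ (e u) := by
  induction u using Finsupp.induction_linear with
  | zero => simp
  | add u v hu hv => simp only [map_add, hu, hv]
  | single k q =>
    have h : constVec V κ (Finsupp.single k q) = Finsupp.single k (algebraMap ℚ V q) := by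
      simp [constVec]
    rw [h, extendVec, Finsupp.linearCombination_single, ← constVec_smul, ← map_smul,
      Finsupp.smul_single_one]

lemma reduceVec_extendVec {κ τ : Type*} (e : (κ →₀ ℚ) →ₗ[ℚ] τ →₀ ℚ) (y : κ →₀ V) :
    reduceVec ρ τ (extendVec V e y) = e (reduceVec ρ κ y) := by
  induction y using Finsupp.induction_linear with
  | zero => simp
  | add u v hu hv => simp only [map_add, hu, hv]
  | single k v =>
    have h : reduceVec ρ κ (Finsupp.single k v) = Finsupp.single k (ρ v) := by
      simp [reduceVec]
    rw [h, extendVec, Finsupp.linearCombination_single, reduceVec_smul, reduceVec_constVec,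
      ← map_smul, Finsupp.smul_single_one]

lemma extendVec_extendVec {κ τ : Type*} (e : (κ →₀ ℚ) ≃ₗ[ℚ] τ →₀ ℚ) (y : κ →₀ V) :
    extendVec V e.symm.toLinearMap (extendVec V e.toLinearMap y) = y := by
  induction y using Finsupp.induction_linear with
  | zero => simp
  | add u v hu hv => simp only [map_add, hu, hv]
  | single k v =>
    have h : (Finsupp.single k v : κ →₀ V) = v • constVec V κ (Finsupp.single k 1) := by
      simp [constVec]
    rw [h, map_smul, map_smul, extendVec_constVec, extendVec_constVec]
    simp

variable [IsDomain V] {ρ R} {ι : Type*} {F : Type*} [AddCommGroup F] [Module R F]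

/-- If a torsion-free module over `R` is written as a quotient of a free module, then
the kernel is free. -/
theorem IsIntegerPreimage.free_ker [IsPrincipalIdealRing V] (h : IsIntegerPreimage ρ x R)
    [Module.IsTorsionFree R F] (f : (ι →₀ R) →ₗ[R] F) :
    Module.Free R (LinearMap.ker f) := by
  have : Module.Free V (kerV h f) :=
    free_of_injective (R := V) (N := kerV h f) (kerV h f).subtype (kerV h f).injective_subtype
  let c := Module.Free.chooseBasis V (kerV h f)
  let ε := Finsupp.linearCombination ℚ fun k ↦ reduceVec ρ ι (c k : ι →₀ V)
  have hε (y) : reduceVec ρ ι (c.repr.symm y : ι →₀ V) = ε (reduceVec ρ _ y) := by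
    induction y using Finsupp.induction_linear with
    | zero => simp
    | add u v hu hv => simp only [map_add, Submodule.coe_add, hu, hv]
    | single k v =>
      have h : reduceVec ρ _ (Finsupp.single k v) = Finsupp.single k (ρ v) := by
        simp [reduceVec]
      rw [h, Finsupp.linearCombination_single, c.repr_symm_single, Submodule.coe_smul,
        reduceVec_smul]
  -- A vector of `kerV` with zero reduction is x times a vector of V^(ι), which lies in `kerV` by
  -- saturation; so its coordinates are divisible by x and reduce to 0.
  have hinj : Function.Injective ε := by
    refine (injective_iff_map_eq_zero ε).2 fun u hu ↦ ?_
    rw [← reduceVec_constVec ρ u, ← hε] at hu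
    obtain ⟨w, hw⟩ := exists_eq_x_smul ρ R h hu
    have hwk : w ∈ kerV h f := mem_kerV_of_x_smul_mem h (hw ▸ Subtype.coe_prop _)
    have hu' : c.repr.symm (constVec V _ u) = x • ⟨w, hwk⟩ := Subtype.ext hw
    rw [LinearEquiv.symm_apply_eq, map_smul] at hu'
    rw [← reduceVec_constVec ρ u, hu', reduceVec_smul, h.apply_self, zero_smul]
  obtain ⟨τ, e, he⟩ := exists_equiv_isIntegralVec ε hinj
  have hsymm (w) : extendVec V e.toLinearMap (extendVec V e.symm.toLinearMap w) = w :=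
    extendVec_extendVec e.symm w
  -- In the basis adapted to the lattice, the kernel becomes the standard R^(τ) inside V^(τ).
  let Λ : LinearMap.ker f →ₗ[R] τ →₀ V :=
    ((extendVec V e.toLinearMap).restrictScalars R) ∘ₗ
      (c.repr.toLinearMap.restrictScalars R) ∘ₗ
      ((inclVec R ι ∘ₗ (LinearMap.ker f).subtype).codRestrict
        ((kerV h f).restrictScalars R) (inclVec_mem_kerV h f))
  have hΛ (p : LinearMap.ker f) : Λ p =
      extendVec V e.toLinearMap (c.repr ⟨inclVec R ι p, inclVec_mem_kerV h f p⟩) := rfl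
  have hΛinj : Function.Injective Λ := by
    intro p q h
    rw [hΛ, hΛ] at h
    have h' := congrArg (extendVec V e.symm.toLinearMap) h
    rw [extendVec_extendVec, extendVec_extendVec, c.repr.injective.eq_iff, Subtype.mk_eq_mk] at h'
    exact Subtype.ext (inclVec_injective R ι h')
  have hrange : LinearMap.range Λ = LinearMap.range (inclVec R τ) := by
    ext y
    constructor
    · rintro ⟨p, rfl⟩
      refine exists_inclVec_eq ρ R h ?_
      rw [hΛ, reduceVec_extendVec]
      refine (he _).1 ?_
      rw [← hε, LinearEquiv.symm_apply_apply]
      exact isIntegralVec_reduceVec_inclVec ρ R h _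
    · rintro ⟨y, rfl⟩
      let z := c.repr.symm (extendVec V e.symm.toLinearMap (inclVec R τ y))
      have hz : IsIntegralVec (reduceVec ρ ι (z : ι →₀ V)) := by
        rw [hε, he, ← LinearEquiv.coe_coe e, ← reduceVec_extendVec, hsymm]
        exact isIntegralVec_reduceVec_inclVec ρ R h y
      obtain ⟨p, hp⟩ := exists_ker_of_mem_kerV h z.2 hz
      refine ⟨p, ?_⟩
      rw [hΛ]
      have : (⟨inclVec R ι p, inclVec_mem_kerV h f p⟩ : kerV h f) = z := Subtype.ext hp
      rw [this, LinearEquiv.apply_symm_apply]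
      exact hsymm _
  exact Module.Free.of_equiv ((LinearEquiv.ofInjective _ (inclVec_injective R τ)).trans
    ((LinearEquiv.ofEq _ _ hrange.symm).trans (LinearEquiv.ofInjective Λ hΛinj).symm))

end Ring

/-! ### The ideal XV of ℤ + XV -/

section Ideal

lemma isIntegerPreimage_intAddXV : IsIntegerPreimage residue x intAddXV where
  ne_zero := x_ne_zero
  apply_self := residue_x
  exists_eq_mul _ := exists_eq_x_mul
  mem_iff _ := mem_intAddXV

/-- The prime ideal `XV` of the ring `ℤ + XV`. -/
def idealXV : Ideal intAddXV := RingHom.ker (residue.comp intAddXV.subtype)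

lemma exists_eq_of_mem_idealXV {a : intAddXV} (ha : a ∈ idealXV) : ∃ w, (a : V) = x * w :=
  exists_eq_x_mul ha

lemma mem_idealXV_of_forall_dvd {a : intAddXV}
    (ha : ∀ n : ℕ, n ≠ 0 → ∃ b : intAddXV, a = n * b) : a ∈ idealXV := by
  obtain ⟨n, hn⟩ := mem_intAddXV.1 a.2
  -- A multiple of |n| + 1 with absolute value |n| must be 0.
  obtain ⟨b, hb⟩ := ha (n.natAbs + 1) (by omega)
  obtain ⟨m, hm⟩ := mem_intAddXV.1 b.2
  have h : (n : ℚ) = ((n.natAbs + 1 : ℕ) * m : ℤ) := by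
    rw [← hn, hb]
    simp [hm]
  have h0 : n = 0 := Int.eq_zero_of_abs_lt_dvd (m := (n.natAbs + 1 : ℕ)) ⟨m, by exact_mod_cast h⟩
    (by rw [Int.abs_eq_natAbs]; omega)
  change residue (a : V) = 0
  rw [hn, h0, Int.cast_zero]

/-- XV is divisible by all nonzero integers, so its functionals to R take values in XV. A dual basis
would then put x in x²V. -/
theorem not_projective_idealXV : ¬ Module.Projective intAddXV idealXV := by
  intro hP
  obtain ⟨s, hs⟩ := Module.projective_def'.1 hP
  have hdual (φ : idealXV →ₗ[intAddXV] intAddXV) (z : idealXV) : φ z ∈ idealXV := by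
    refine mem_idealXV_of_forall_dvd fun n hn ↦ ?_
    obtain ⟨w, hw⟩ := exists_eq_of_mem_idealXV z.2
    let y : intAddXV := ⟨x * (w * algebraMap ℚ V (n : ℚ)⁻¹), x_mul_mem _⟩
    have hy : y ∈ idealXV := by
      change residue (x * _) = 0
      simp
    refine ⟨φ ⟨y, hy⟩, ?_⟩
    have hz : z = (n : intAddXV) • (⟨y, hy⟩ : idealXV) := by
      refine Subtype.ext (Subtype.ext ?_)
      have hd : (n : V) * algebraMap ℚ V (n : ℚ)⁻¹ = 1 := by
        rw [← algebraMap_rat_natCast, ← map_mul, mul_inv_cancel₀ (by simpa using hn), map_one]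
      simp only [Submodule.coe_smul, smul_eq_mul, Subring.coe_mul, y, Subring.coe_natCast, hw]
      linear_combination (-(x * w)) * hd
    rw [hz, map_smul, smul_eq_mul]
  have hx : (⟨x * 1, x_mul_mem 1⟩ : intAddXV) ∈ idealXV := by
    change residue (x * 1) = 0
    simp
  have h := congrArg (fun z : idealXV ↦ ((z : intAddXV) : V)) (LinearMap.congr_fun hs ⟨_, hx⟩)
  simp only [LinearMap.comp_apply, Finsupp.linearCombination_apply, Finsupp.sum, id,
    LinearMap.id_apply, Submodule.coe_sum, Submodule.coe_smul, smul_eq_mul] at h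
  have hdvd : x * x ∣ x * 1 := by
    rw [← h, ← Subring.coe_subtype, map_sum]
    refine Finset.dvd_sum fun z _ ↦ ?_
    rw [map_mul]
    refine mul_dvd_mul ?_ ?_
    · exact exists_eq_of_mem_idealXV (hdual (Finsupp.lapply z ∘ₗ s) ⟨_, hx⟩)
    · exact exists_eq_of_mem_idealXV z.2
  obtain ⟨v, hv⟩ := (mul_dvd_mul_iff_left x_ne_zero).1 hdvd
  have := congrArg residue hv
  simp at this

/-- A submodule of a flat module over `ℤ + XV` is flat. -/
lemma flat_of_injective {K P : Type*} [AddCommGroup K] [Module intAddXV K] [AddCommGroup P]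
    [Module intAddXV P] [Module.Flat intAddXV P] (f : K →ₗ[intAddXV] P)
    (hf : Function.Injective f) : Module.Flat intAddXV K := by
  rw [Module.Flat.flat_iff_torsion_eq_bot_of_isBezout, ← Submodule.isTorsionFree_iff_torsion_eq_bot]
  exact hf.moduleIsTorsionFree f (map_smul f)

end Ideal

/-! ### Modules over a product through their components -/

section Transfer

open TensorProduct

lemma lTensor_eq_of_rTensor_eq {R X T P : Type*} [CommRing R] [AddCommGroup X] [Module R X]
    [AddCommGroup T] [Module R T] [Module.Flat R T] [AddCommMonoid P] [Module R P]
    (Q : Submodule R P) (f : X →ₗ[R] T) {z w : Q ⊗[R] X}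
    (h : Q.subtype.rTensor X z = Q.subtype.rTensor X w) : f.lTensor Q z = f.lTensor Q w := by
  refine Module.Flat.rTensor_preserves_injective_linearMap (M := T) Q.subtype
    Q.injective_subtype ?_
  rw [← LinearMap.comp_apply, ← LinearMap.comp_apply, LinearMap.rTensor_comp_lTensor,
    ← LinearMap.lTensor_comp_rTensor, LinearMap.comp_apply, LinearMap.comp_apply, h]

lemma flat_prod {R M N : Type*} [CommRing R] [AddCommGroup M] [Module R M] [AddCommGroup N]
    [Module R N] [Module.Flat R M] [Module.Flat R N] : Module.Flat R (M × N) := by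
  rw [Module.Flat.iff_rTensor_injectiveₛ]
  intro P _ _ Q
  have hprod {Q : Type _} [AddCommMonoid Q] [Module R Q] (z : Q ⊗[R] (M × N)) :
      TensorProduct.prodRight R R Q M N z =
        ((LinearMap.fst R M N).lTensor Q z, (LinearMap.snd R M N).lTensor Q z) := by
    induction z with
    | zero => simp only [map_zero, Prod.mk_zero_zero]
    | tmul a b => simp
    | add a b ha hb => simp only [map_add, ha, hb, Prod.mk_add_mk]
  intro z w h
  apply (TensorProduct.prodRight R R Q M N).injective
  rw [hprod, hprod, lTensor_eq_of_rTensor_eq Q _ h, lTensor_eq_of_rTensor_eq Q _ h]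

lemma projective_trans {A S : Type*} (N : Type*) [CommRing A] [CommRing S] [Algebra A S]
    [AddCommGroup N]
    [Module A N] [Module S N] [IsScalarTower A S N] [Module.Projective A S]
    [Module.Projective S N] : Module.Projective A N := by
  obtain ⟨s, hs⟩ := Module.projective_def'.1 ‹Module.Projective S N›
  have : Module.Projective A (N →₀ S) := by
    classical exact .of_equiv' (finsuppLEquivDirectSum A S N).symm
  exact .of_split (s.restrictScalars A) ((Finsupp.linearCombination S id).restrictScalars A)
    (LinearMap.ext fun n ↦ LinearMap.congr_fun hs n)

/-- If `K → P → M` is the kernel of a linear map between projective modules that is surjective,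
then `K` is projective. -/
lemma projective_of_exact {R K P M : Type*} [CommRing R] [AddCommGroup K] [Module R K]
    [AddCommGroup P] [Module R P] [AddCommGroup M] [Module R M] [Module.Projective R P]
    [Module.Projective R M] (g : K →ₗ[R] P) (f : P →ₗ[R] M) (hg : Function.Injective g)
    (hgf : Function.Exact g f) (hf : Function.Surjective f) : Module.Projective R K := by
  obtain ⟨s, hs⟩ := Module.projective_lifting_property f LinearMap.id hf
  have hmem (p : P) : p - s (f p) ∈ LinearMap.range g := by
    refine (hgf _).1 ?_
    rw [map_sub, ← LinearMap.comp_apply f s, hs, LinearMap.id_apply, sub_self]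
  let e := LinearEquiv.ofInjective g hg
  refine .of_split g (e.symm.toLinearMap ∘ₗ
    (LinearMap.id - s ∘ₗ f).codRestrict (LinearMap.range g) hmem) (LinearMap.ext fun k ↦ ?_)
  refine e.symm_apply_eq.2 (Subtype.ext ?_)
  change g k - s (f (g k)) = g k
  rw [hgf.apply_apply_eq_zero, map_zero, sub_zero]

variable {A S R : Type*} [CommRing A] [CommRing S] [CommRing R] [Algebra A S] [Algebra A R]

lemma projective_fst (e : A ≃ₗ[A] S × R) : Module.Projective A S :=
  .of_split (e.symm.toLinearMap ∘ₗ LinearMap.inl A S R) (LinearMap.fst A S R ∘ₗ e.toLinearMap)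
    (by ext; simp)

lemma projective_snd (e : A ≃ₗ[A] S × R) : Module.Projective A R :=
  .of_split (e.symm.toLinearMap ∘ₗ LinearMap.inr A S R) (LinearMap.snd A S R ∘ₗ e.toLinearMap)
    (by ext; simp)

/-- A module over `S × R` is the product of its base changes to `S` and `R`. -/
def prodTensorEquiv (e : A ≃ₗ[A] S × R) (M : Type*) [AddCommGroup M] [Module A M] :
    M ≃ₗ[A] (S ⊗[A] M) × (R ⊗[A] M) :=
  (TensorProduct.lid A M).symm ≪≫ₗ e.rTensor M ≪≫ₗ TensorProduct.prodLeft A A S R M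

lemma flat_of_components (e : A ≃ₗ[A] S × R) {M : Type*} [AddCommGroup M] [Module A M]
    [Module.Flat S (S ⊗[A] M)] [Module.Flat R (R ⊗[A] M)] : Module.Flat A M :=
  have := projective_fst e
  have := projective_snd e
  have := Module.Flat.trans A S (S ⊗[A] M)
  have := Module.Flat.trans A R (R ⊗[A] M)
  have := flat_prod (R := A) (M := S ⊗[A] M) (N := R ⊗[A] M)
  .of_linearEquiv (prodTensorEquiv e M)

lemma projective_of_components (e : A ≃ₗ[A] S × R) {M : Type*} [AddCommGroup M] [Module A M]
    [Module.Projective S (S ⊗[A] M)] [Module.Projective R (R ⊗[A] M)] : Module.Projective A M :=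
  have := projective_fst e
  have := projective_snd e
  have := projective_trans (A := A) (S := S) (S ⊗[A] M)
  have := projective_trans (A := A) (S := R) (R ⊗[A] M)
  .of_equiv' (prodTensorEquiv e M).symm

section Kernel

variable (B : Type*) [CommRing B] [Algebra A B] {P M : Type*} [AddCommGroup P] [Module A P]
  [AddCommGroup M] [Module A M] (f : P →ₗ[A] M)

lemma baseChange_ker_injective [Module.Flat A B] :
    Function.Injective ((LinearMap.ker f).subtype.baseChange B) :=
  Module.Flat.lTensor_preserves_injective_linearMap (M := B) _ (LinearMap.ker f).injective_subtype

lemma baseChange_ker_exact [Module.Flat A B] :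
    Function.Exact ((LinearMap.ker f).subtype.baseChange B) (f.baseChange B) :=
  Module.Flat.lTensor_exact B (LinearMap.exact_subtype_ker_map f)

variable {f} in
lemma baseChange_surjective (hf : Function.Surjective f) :
    Function.Surjective (f.baseChange B) :=
  LinearMap.lTensor_surjective B hf

/-- Flat base change commutes with kernels. -/
def baseChangeKerEquiv [Module.Flat A B] :
    (B ⊗[A] LinearMap.ker f) ≃ₗ[B] LinearMap.ker (f.baseChange B) :=
  (LinearEquiv.ofInjective _ (baseChange_ker_injective B f)).trans
    (LinearEquiv.ofEq _ _ (baseChange_ker_exact B f).linearMap_ker_eq.symm)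

end Kernel

end Transfer

/-! ### Flat dimension under flat base change -/

section FlatDim

open TensorProduct

lemma hasFlatDimLE_of_equiv {R : Type u} [CommRing R] (n : ℕ) {M N : ModuleCat.{u} R}
    (e : M ≃ₗ[R] N) (h : HasFlatDimLE n M) : HasFlatDimLE n N := by
  induction n generalizing M N with
  | zero =>
    have : Module.Flat R M := h
    exact Module.Flat.of_linearEquiv e.symm
  | succ n ih =>
    obtain ⟨F, p, hF, hp, hK⟩ := h
    refine ⟨F, e.toLinearMap ∘ₗ p, hF, e.surjective.comp hp, ?_⟩
    exact ih (M := ModuleCat.of R (LinearMap.ker p))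
      (N := ModuleCat.of R (LinearMap.ker (e.toLinearMap ∘ₗ p)))
      (LinearEquiv.ofEq (LinearMap.ker p) (LinearMap.ker (e.toLinearMap ∘ₗ p))
        (LinearEquiv.ker_comp e p).symm) hK

lemma hasFlatDimLE_baseChange {A S : Type u} [CommRing A] [CommRing S] [Algebra A S]
    [Module.Flat A S] (n : ℕ) (M : ModuleCat.{u} A) (h : HasFlatDimLE n M) :
    HasFlatDimLE n (ModuleCat.of S (S ⊗[A] M)) := by
  induction n generalizing M with
  | zero =>
    have : Module.Flat A M := h
    exact Module.Flat.baseChange A S M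
  | succ n ih =>
    obtain ⟨F, p, hF, hp, hK⟩ := h
    refine ⟨ModuleCat.of S (S ⊗[A] F), p.baseChange S, Module.Flat.baseChange A S F,
      baseChange_surjective S hp, ?_⟩
    exact hasFlatDimLE_of_equiv n (baseChangeKerEquiv S p) (ih _ hK)

lemma exists_hasFlatDimLE {R : Type u} [CommRing R] {M : ModuleCat.{u} R} (h : flatDim M < ⊤) :
    ∃ n, HasFlatDimLE n M := by
  by_contra! H
  exact h.ne (by simp [flatDim, H])

lemma flatDim_le {R : Type u} [CommRing R] {M : ModuleCat.{u} R} {n : ℕ} (h : HasFlatDimLE n M) :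
    flatDim M ≤ n := iInf₂_le n h

lemma one_le_flatDim {R : Type u} [CommRing R] {M : ModuleCat.{u} R} (h : ¬ Module.Flat R M) :
    1 ≤ flatDim M := by
  refine le_iInf₂ fun n hn ↦ ?_
  rcases n with _ | n
  · exact absurd hn h
  · exact_mod_cast Nat.succ_pos n

/-- The flat dimension does not increase under restriction to a flat surjective algebra. -/
lemma weakDim_le_of_surjective {A S : Type u} [CommRing A] [CommRing S] [Algebra A S]
    [Module.Flat A S] (hA : Function.Surjective (algebraMap A S)) : weakDim S ≤ weakDim A := by
  refine iSup_le fun N ↦ ?_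
  let := Module.compHom N (algebraMap A S)
  have : IsScalarTower A S N := .of_algebraMap_smul fun _ _ ↦ rfl
  refine le_trans ?_ (le_iSup (fun M : ModuleCat.{u} A ↦ flatDim M) (ModuleCat.of A N))
  refine le_iInf₂ fun n hn ↦ flatDim_le ?_
  -- For an epimorphism, S ⊗ N recovers N, so resolutions over A base change to resolutions over S.
  have := Algebra.isEpi_of_surjective_algebraMap A S hA
  exact hasFlatDimLE_of_equiv n (TensorProduct.lid' A S N) (hasFlatDimLE_baseChange n _ hn)

end FlatDim

/-! ### Projective dimension, syzygies and cotorsion dimension -/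

section ProjDim

lemma projDim_le_iff {R : Type u} [CommRing R] (M : ModuleCat.{u} R) (n : ℕ) :
    projDim M ≤ n ↔ HasProjectiveDimensionLT M (n + 1) := by
  have := projectiveDimension_le_iff M n
  rw [HasProjectiveDimensionLE] at this
  rw [← this, projDim]
  cases projectiveDimension M with
  | bot => simp
  | coe a => exact WithBot.coe_le_coe.symm

lemma exists_hasProjectiveDimensionLT {R : Type u} [CommRing R] {M : ModuleCat.{u} R}
    (h : projDim M < ⊤) : ∃ n, HasProjectiveDimensionLT M (n + 1) := by
  obtain ⟨n, hn⟩ := ENat.ne_top_iff_exists.1 h.ne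
  exact ⟨n, (projDim_le_iff M n).1 hn.ge⟩

variable {R : Type u} [CommRing R] {P M : Type u} [AddCommGroup P] [Module R P] [AddCommGroup M]
  [Module R M]

lemma hasProjectiveDimensionLT_ker_iff [Module.Projective R P] {f : P →ₗ[R] M}
    (hf : Function.Surjective f) (n : ℕ) :
    HasProjectiveDimensionLT (ModuleCat.of R M) (n + 2) ↔
      HasProjectiveDimensionLT (ModuleCat.of R (LinearMap.ker f)) (n + 1) :=
  (LinearMap.shortExact_shortComplexKer hf).hasProjectiveDimensionLT_X₃_iff n
    ((IsProjective.iff_projective P).1 ‹_›)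

lemma hasProjectiveDimensionLT_one_iff :
    HasProjectiveDimensionLT (ModuleCat.of R M) 1 ↔ Module.Projective R M := by
  rw [← projective_iff_hasProjectiveDimensionLT_one, ← IsProjective.iff_projective]

lemma hasFlatDimLE_of_hasProjectiveDimensionLT (n : ℕ) (M : ModuleCat.{u} R)
    (h : HasProjectiveDimensionLT M (n + 1)) : HasFlatDimLE n M := by
  induction n generalizing M with
  | zero =>
    have : Module.Projective R M := hasProjectiveDimensionLT_one_iff.1 h
    exact Module.Flat.of_projective
  | succ n ih =>
    have hs := Finsupp.linearCombination_id_surjective R M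
    exact ⟨ModuleCat.of R (M →₀ R), Finsupp.linearCombination R id, Module.Flat.finsupp M, hs,
      ih _ ((hasProjectiveDimensionLT_ker_iff hs n).1 h)⟩

/-- Every flat module that is not projective is the source of a nontrivial extension. -/
lemma one_le_globalCotorsionDim (F : ModuleCat.{u} R) [Module.Flat R F]
    (hF : ¬ Module.Projective R F) : 1 ≤ globalCotorsionDim R := by
  have h : ¬ Projective F := fun h ↦ hF ((IsProjective.iff_projective (R := R) F).2 h)
  rw [projective_iff_subsingleton_ext_one.{u}] at h
  push Not at h
  obtain ⟨M, hM⟩ := h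
  refine le_trans ?_ (le_iSup (fun M : ModuleCat.{u} R ↦ cotorsionDim M) M)
  refine le_iInf₂ fun n hn ↦ ?_
  rcases n with _ | n
  · exact absurd (hn F ‹_›) (not_subsingleton_iff_nontrivial.2 hM)
  · exact_mod_cast Nat.succ_pos n

lemma globalCotorsionDim_le (n : ℕ) (h : ∀ F : ModuleCat.{u} R, Module.Flat R F →
    HasProjectiveDimensionLT F (n + 1)) : globalCotorsionDim R ≤ n := by
  refine iSup_le fun M ↦ iInf₂_le n fun F hF ↦ ?_
  have := h F hF
  exact HasProjectiveDimensionLT.subsingleton F (n + 1) (n + 1) le_rfl M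

end ProjDim

/-! ### Dimensions of S × (ℤ + XV) -/

section Product

open TensorProduct

/-- A ring with bijective structure map to `S × R` is linearly equivalent to `S × R`. -/
def prodEquivOfBijective {A S R : Type*} [CommRing A] [CommRing S] [CommRing R] [Algebra A S]
    [Algebra A R]
    (h : Function.Bijective fun a : A ↦ (algebraMap A S a, algebraMap A R a)) : A ≃ₗ[A] S × R :=
  LinearEquiv.ofBijective ((Algebra.linearMap A S).prod (Algebra.linearMap A R)) h

variable {A S : Type u} [CommRing A] [CommRing S] [Algebra A S] [Algebra A intAddXV]
  (h : Function.Bijective fun a : A ↦ (algebraMap A S a, algebraMap A intAddXV a))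

include h

/-- If `M` has finite flat dimension, then the kernel of every surjection from a flat module onto
`M` is flat. -/
lemma flat_ker (hS : IsPerfect S) {n : ℕ} {M : ModuleCat.{u} A} (hM : HasFlatDimLE n M)
    {P : Type u} [AddCommGroup P] [Module A P] [Module.Flat A P] (f : P →ₗ[A] M)
    (hf : Function.Surjective f) : Module.Flat A (LinearMap.ker f) := by
  let e := prodEquivOfBijective h
  have := projective_fst e
  have := projective_snd e
  have hSM := hS.principalDCC.flat_of_hasFlatDimLE hS n _ (hasFlatDimLE_baseChange (S := S) n M hM)
  have : Module.Projective S (S ⊗[A] M) := hS (ModuleCat.of S (S ⊗[A] M)) hSM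
  have : Module.Projective S (S ⊗[A] P) :=
    hS (ModuleCat.of S (S ⊗[A] P)) (Module.Flat.baseChange A S P)
  -- Over S the sequence splits; over ℤ + XV the kernel is a submodule of a flat module.
  have : Module.Projective S (S ⊗[A] LinearMap.ker f) :=
    projective_of_exact _ _ (baseChange_ker_injective S f) (baseChange_ker_exact S f)
      (baseChange_surjective S hf)
  have : Module.Flat intAddXV (intAddXV ⊗[A] LinearMap.ker f) :=
    flat_of_injective _ (baseChange_ker_injective intAddXV f)
  exact flat_of_components e

/-- The kernel of a surjection from a free module onto a flat module is projective. -/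
lemma projective_ker (hS : IsPerfect S) {ι M : Type u} [AddCommGroup M] [Module A M]
    [Module.Flat A M] (f : (ι →₀ A) →ₗ[A] M)
    (hf : Function.Surjective f) : Module.Projective A (LinearMap.ker f) := by
  let e := prodEquivOfBijective h
  have := projective_fst e
  have := projective_snd e
  have : Module.Projective S (S ⊗[A] M) :=
    hS (ModuleCat.of S (S ⊗[A] M)) (Module.Flat.baseChange A S M)
  have : Module.Projective S (S ⊗[A] LinearMap.ker f) :=
    projective_of_exact _ _ (baseChange_ker_injective S f) (baseChange_ker_exact S f)
      (baseChange_surjective S hf)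
  classical
  let b := TensorProduct.finsuppScalarRight A intAddXV intAddXV ι
  have hfree : Module.Free intAddXV
      (LinearMap.ker (f.baseChange intAddXV ∘ₗ b.symm.toLinearMap)) :=
    isIntegerPreimage_intAddXV.free_ker _
  have hker : LinearMap.ker (f.baseChange intAddXV ∘ₗ b.symm.toLinearMap) =
      (LinearMap.ker (f.baseChange intAddXV)).comap b.symm.toLinearMap := LinearMap.ker_comp _ _
  have : Module.Projective intAddXV (intAddXV ⊗[A] LinearMap.ker f) := by
    let c := (LinearEquiv.ofEq _ _ hker).trans
      (b.symm.ofSubmodule' (LinearMap.ker (f.baseChange intAddXV)))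
    exact .of_equiv' (c.trans (baseChangeKerEquiv intAddXV f).symm)
  exact projective_of_components (M := LinearMap.ker f) e

lemma hasProjectiveDimensionLT_two_of_flat (hS : IsPerfect S) (F : ModuleCat.{u} A)
    (hF : Module.Flat A F) : HasProjectiveDimensionLT F 2 := by
  have hs := Finsupp.linearCombination_id_surjective A F
  exact (hasProjectiveDimensionLT_ker_iff hs 0).2
    (hasProjectiveDimensionLT_one_iff.2 (projective_ker h hS _ hs))

omit h in
variable (A S) in
/-- The ideal `0 × XV` of a product `S × (ℤ + XV)`. -/
def prodIdeal : Ideal A := RingHom.ker (algebraMap A S) ⊓ idealXV.comap (algebraMap A intAddXV)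

/-- The idempotent (1, 0) acts as the identity on S and as zero on the ideal. -/
lemma subsingleton_tensor_prodIdeal : Subsingleton (S ⊗[A] prodIdeal A S) := by
  obtain ⟨a, ha⟩ := h.2 (1, 0)
  have ha1 : algebraMap A S a = 1 := congrArg Prod.fst ha
  have ha0 : algebraMap A intAddXV a = 0 := congrArg Prod.snd ha
  refine subsingleton_of_forall_eq 0 fun z ↦ ?_
  induction z with
  | zero => rfl
  | add z w hz hw => rw [hz, hw, add_zero]
  | tmul s i =>
    have hs : s = a • s := by rw [Algebra.smul_def, ha1, one_mul]
    have hi : a • i = 0 := by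
      refine Subtype.ext (h.1 (Prod.ext ?_ ?_))
      · have : algebraMap A S i = 0 := i.2.1
        simp [this]
      · simp [ha0]
    rw [hs, TensorProduct.smul_tmul, hi, TensorProduct.tmul_zero]

lemma flat_prodIdeal : Module.Flat A (prodIdeal A S) := by
  let e := prodEquivOfBijective h
  have := projective_snd e
  have := subsingleton_tensor_prodIdeal h
  have : Module.Flat S (S ⊗[A] prodIdeal A S) := Module.Flat.of_projective
  have : Module.Flat intAddXV (intAddXV ⊗[A] prodIdeal A S) :=
    flat_of_injective ((prodIdeal A S).subtype.baseChange intAddXV)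
      (Module.Flat.lTensor_preserves_injective_linearMap (M := intAddXV) _
        (prodIdeal A S).injective_subtype)
  exact flat_of_components e

/-- Projectivity would pass to the base change to ℤ + XV, which is XV itself. -/
lemma not_projective_prodIdeal : ¬ Module.Projective A (prodIdeal A S) := by
  intro hP
  have := projective_snd (prodEquivOfBijective h)
  let φ : intAddXV ⊗[A] prodIdeal A S →ₗ[intAddXV] intAddXV :=
    (TensorProduct.AlgebraTensorModule.rid A intAddXV intAddXV).toLinearMap ∘ₗ
      (prodIdeal A S).subtype.baseChange intAddXV
  have hφ : Function.Injective φ :=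
    (TensorProduct.AlgebraTensorModule.rid A intAddXV intAddXV).injective.comp
      (Module.Flat.lTensor_preserves_injective_linearMap (M := intAddXV) _
        (prodIdeal A S).injective_subtype)
  have hφt (r) (i : prodIdeal A S) : φ (r ⊗ₜ i) = algebraMap A intAddXV i * r := by
    simp [φ, Algebra.smul_def]
  have hrange : LinearMap.range φ = idealXV := by
    refine le_antisymm ?_ fun y hy ↦ ?_
    · rintro _ ⟨z, rfl⟩
      induction z with
      | zero => simp
      | add z w hz hw => rw [map_add]; exact add_mem hz hw
      | tmul r i =>
        rw [hφt]
        exact idealXV.mul_mem_right _ i.2.2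
    · obtain ⟨a, ha⟩ := h.2 (0, y)
      have hay : algebraMap A intAddXV a = y := congrArg Prod.snd ha
      refine ⟨1 ⊗ₜ ⟨a, congrArg Prod.fst ha, ?_⟩, ?_⟩
      · change algebraMap A intAddXV a ∈ idealXV
        rwa [hay]
      · rw [hφt, mul_one, hay]
  exact not_projective_idealXV
    (.of_equiv' ((LinearEquiv.ofInjective φ hφ).trans (LinearEquiv.ofEq _ _ hrange)))

theorem globalCotorsionDim_eq_one (hS : IsPerfect S) : globalCotorsionDim A = 1 :=
  have := flat_prodIdeal h
  le_antisymm
    (globalCotorsionDim_le 1 fun F hF ↦ hasProjectiveDimensionLT_two_of_flat h hS F hF)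
    (one_le_globalCotorsionDim (ModuleCat.of A (prodIdeal A S)) (not_projective_prodIdeal h))

/-- The first syzygy is flat, and flat modules have projective dimension at most 1. -/
lemma projDim_le_two (hS : IsPerfect S) {n : ℕ} {M : ModuleCat.{u} A} (hM : HasFlatDimLE n M) :
    projDim M ≤ 2 := by
  have hs := Finsupp.linearCombination_id_surjective A M
  refine (projDim_le_iff M 2).2 ((hasProjectiveDimensionLT_ker_iff hs 1).2 ?_)
  exact hasProjectiveDimensionLT_two_of_flat h hS _ (flat_ker h hS hM _ hs)

lemma flatDim_le_one (hS : IsPerfect S) {n : ℕ} {M : ModuleCat.{u} A} (hM : HasFlatDimLE n M) :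
    flatDim M ≤ 1 := by
  have hs := Finsupp.linearCombination_id_surjective A M
  exact flatDim_le (n := 1)
    ⟨ModuleCat.of A (M →₀ A), _, Module.Flat.finsupp M, hs, flat_ker h hS hM _ hs⟩

lemma hasFlatDimLE_one_quotient :
    HasFlatDimLE 1 (ModuleCat.of A (A ⧸ prodIdeal A S)) := by
  have := flat_prodIdeal h
  exact ⟨ModuleCat.of A A, (prodIdeal A S).mkQ, Module.Flat.self, (prodIdeal A S).mkQ_surjective,
    Module.Flat.of_linearEquiv (LinearEquiv.ofEq _ _ (prodIdeal A S).ker_mkQ)⟩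

lemma not_hasProjectiveDimensionLT_two_quotient :
    ¬ HasProjectiveDimensionLT (ModuleCat.of A (A ⧸ prodIdeal A S)) 2 := by
  rw [hasProjectiveDimensionLT_ker_iff (prodIdeal A S).mkQ_surjective 0,
    hasProjectiveDimensionLT_one_iff]
  exact fun hP ↦ not_projective_prodIdeal h
    (.of_equiv' (LinearEquiv.ofEq _ _ (prodIdeal A S).ker_mkQ))

theorem FPD_eq_two (hS : IsPerfect S) : FPD A = 2 := by
  refine le_antisymm (iSup₂_le fun M hM ↦ ?_) ?_
  · obtain ⟨n, hn⟩ := exists_hasProjectiveDimensionLT hM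
    exact projDim_le_two h hS (hasFlatDimLE_of_hasProjectiveDimensionLT n M hn)
  · have hle := projDim_le_two h hS (hasFlatDimLE_one_quotient h)
    refine le_trans ?_ (le_iSup₂_of_le (ModuleCat.of A (A ⧸ prodIdeal A S))
      (hle.trans_lt (ENat.natCast_lt_top 2)) le_rfl)
    by_contra hlt
    refine not_hasProjectiveDimensionLT_two_quotient h ((projDim_le_iff _ 1).1 ?_)
    exact Order.le_of_lt_add_one (not_le.1 hlt)

theorem FFD_eq_one (hS : IsPerfect S) : FFD A = 1 := by
  refine le_antisymm (iSup₂_le fun M hM ↦ ?_) ?_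
  · obtain ⟨n, hn⟩ := exists_hasFlatDimLE hM
    exact flatDim_le_one h hS hn
  · have hle := flatDim_le_one h hS (hasFlatDimLE_one_quotient h)
    refine le_trans (one_le_flatDim fun hF ↦ ?_)
      (le_iSup₂_of_le (ModuleCat.of A (A ⧸ prodIdeal A S))
        (hle.trans_lt (ENat.natCast_lt_top 1)) le_rfl)
    -- If the quotient were flat, its projective dimension would be at most 1.
    exact not_hasProjectiveDimensionLT_two_quotient h
      (hasProjectiveDimensionLT_two_of_flat h hS _ hF)

theorem weakDim_eq_top (hwS : weakDim S = ⊤) : weakDim A = ⊤ := by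
  have := projective_fst (prodEquivOfBijective h)
  rw [eq_top_iff, ← hwS]
  refine weakDim_le_of_surjective fun s ↦ ?_
  obtain ⟨a, ha⟩ := h.2 (s, 0)
  exact ⟨a, congrArg Prod.fst ha⟩

end Product

end HomDim

end

theorem mainTheorem11 (S : Type u) [CommRing S] (hS : HomDim.IsPerfect S)
    (hwS : HomDim.weakDim S = ⊤) :
    HomDim.globalCotorsionDim (S × HomDim.intAddXV) = 1 ∧
    HomDim.FPD (S × HomDim.intAddXV) = 2 ∧
    HomDim.FFD (S × HomDim.intAddXV) = 1 ∧
    HomDim.weakDim (S × HomDim.intAddXV) = ⊤ ∧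
    HomDim.globalCotorsionDim (S × HomDim.intAddXV) < HomDim.FPD (S × HomDim.intAddXV) ∧
    HomDim.FPD (S × HomDim.intAddXV) =
      HomDim.globalCotorsionDim (S × HomDim.intAddXV) + HomDim.FFD (S × HomDim.intAddXV) := by
  let _ : Algebra (S × HomDim.intAddXV) S := (RingHom.fst S HomDim.intAddXV).toAlgebra
  let _ : Algebra (S × HomDim.intAddXV) HomDim.intAddXV :=
    (RingHom.snd S HomDim.intAddXV).toAlgebra
  have h : Function.Bijective fun a : S × HomDim.intAddXV ↦
      (algebraMap (S × HomDim.intAddXV) S a,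
        algebraMap (S × HomDim.intAddXV) HomDim.intAddXV a) := Function.bijective_id
  have h₁ := HomDim.globalCotorsionDim_eq_one h hS
  have h₂ := HomDim.FPD_eq_two h hS
  have h₃ := HomDim.FFD_eq_one h hS
  refine ⟨h₁, h₂, h₃, HomDim.weakDim_eq_top h hwS, ?_, ?_⟩
  · rw [h₁, h₂]
    norm_num
  · rw [h₁, h₂, h₃]
    norm_num
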